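/- For real $t$ and complex $s$ let $P_t(s)=\sum_{p\le t}p^{-s}$, the sum being over the primes $p\le t$. For $T>0$ let $\tau$ be uniformly distributed on $[T,2T]$. Then for each real $t>e$ the random variables $$\frac{\operatorname{Re}P_t(\tfrac12+i\tau)}{\sqrt{\tfrac12\log\log t}}\qquad\text{and}\qquad \frac{\operatorname{Im}P_t(\tfrac12+i\tau)}{\sqrt{\tfrac12\log\log t}}$$ converge in distribution, as $T\to\infty$, to probability laws $\nu_t^{\mathrm{Re}}$ and $\nu_t^{\mathrm{Im}}$ on $\mathbb{R}$, respectively; and, as $t\to\infty$, both $\nu_t^{\mathrm{Re}}$ and $\nu_t^{\mathrm{Im}}$ converge weakly to the standard normal law $\mathcal{N}(0,1)$. -/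

import Mathlib

open Filter Topology MeasureTheory ProbabilityTheory

/-- The finite prime Dirichlet series `P_t(s) = ∑_{p ≤ t} p^{-s}`, the sum being over primes `p`. -/
noncomputable def primeSum (t : ℝ) (s : ℂ) : ℂ :=
  ∑ p ∈ (Finset.range (⌊t⌋₊ + 1)).filter Nat.Prime, (p : ℂ) ^ (-s)

/-- The uniform distribution on the interval `[T, 2T]`, for `T > 0`. -/
noncomputable def uniformMeasure (T : Set.Ioi (0 : ℝ)) : Measure ℝ :=
  ProbabilityTheory.cond volume (Set.Icc (T : ℝ) (2 * T))

instance uniformMeasure_isProbabilityMeasure (T : Set.Ioi (0 : ℝ)) :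
    IsProbabilityMeasure (uniformMeasure T) := by
  have hT : (0 : ℝ) < T := T.2
  refine ProbabilityTheory.cond_isProbabilityMeasure_of_finite ?_ ?_
  · rw [Real.volume_Icc]
    simp only [ne_eq, ENNReal.ofReal_eq_zero, not_le]
    linarith
  · rw [Real.volume_Icc]
    exact ENNReal.ofReal_ne_top

/-- The standard normal law `N(0,1)`. -/
noncomputable def stdNormal : ProbabilityMeasure ℝ := ⟨gaussianReal 0 1, inferInstance⟩

/-! For fixed `t` the phases of `p ^ (-iτ)`, `p ≤ t`, trace a linear flow on a finite torus.
Logarithms of primes are linearly independent over the integers, so by Kronecker–Weyl the flow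
equidistributes (`tendstoInDistribution_comp_torusFlow`). The limit law is thus that of a weighted
sum of independent variables `Re (v * e(θ))`, with `v = 1` for the real part and `v = -i` for the
imaginary part.

As `t → ∞` this is a central limit theorem for bounded independent summands: each coefficient is at
most `1 / √(½ log log t)`, and the characteristic function is compared with the Gaussian one factor
by factor (`norm_charFun_torusSum_sub_le`). The variance tends to 1 because the sum of `1 / p` over
`p ≤ t` is asymptotic to `log log t` (`tendsto_sum_inv_primes_div_log_log`). -/

/-! ### The sum of reciprocals of primes -/

/-- The completely multiplicative function `n ↦ n ^ (-s)`, as a monoid homomorphism. -/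
noncomputable def rpowNegHom (s : ℝ) : ℕ →* ℝ where
  toFun n := (n : ℝ) ^ (-s)
  map_one' := by simp
  map_mul' m n := by
    push_cast
    exact Real.mul_rpow (Nat.cast_nonneg m) (Nat.cast_nonneg n)

theorem rpowNegHom_apply (s : ℝ) (n : ℕ) : rpowNegHom s n = (n : ℝ) ^ (-s) := rfl

theorem rpow_neg_prime_lt_one {s : ℝ} (hs : 0 < s) {p : ℕ} (hp : p.Prime) :
    (p : ℝ) ^ (-s) < 1 :=
  Real.rpow_lt_one_of_one_lt_of_neg (by exact_mod_cast hp.one_lt) (by linarith)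

theorem hasSum_smoothNumbers_rpow {s : ℝ} (hs : 0 < s) (N : ℕ) :
    HasSum (fun m : N.smoothNumbers ↦ ((m : ℕ) : ℝ) ^ (-s))
      (∏ p ∈ N.primesBelow, (1 - (p : ℝ) ^ (-s))⁻¹) := by
  refine (EulerProduct.summable_and_hasSum_smoothNumbers_prod_primesBelow_geometric
    (f := rpowNegHom s) (fun {p} hp ↦ ?_) N).2
  rw [rpowNegHom_apply, Real.norm_of_nonneg (by positivity)]
  exact rpow_neg_prime_lt_one hs hp

theorem log_eulerProduct_eq_sum {s : ℝ} (hs : 0 < s) (N : ℕ) :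
    Real.log (∏ p ∈ N.primesBelow, (1 - (p : ℝ) ^ (-s))⁻¹) =
      ∑ p ∈ N.primesBelow, -Real.log (1 - (p : ℝ) ^ (-s)) := by
  rw [Real.log_prod]
  · simp_rw [Real.log_inv]
  · intro p hp
    have := rpow_neg_prime_lt_one hs (Nat.prime_of_mem_primesBelow hp)
    exact inv_ne_zero (by linarith)

theorem eulerProduct_pos {s : ℝ} (hs : 0 < s) (N : ℕ) :
    0 < ∏ p ∈ N.primesBelow, (1 - (p : ℝ) ^ (-s))⁻¹ := by
  refine Finset.prod_pos fun p hp ↦ inv_pos.mpr ?_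
  linarith [rpow_neg_prime_lt_one hs (Nat.prime_of_mem_primesBelow hp)]

theorem sum_primesBelow_rpow_le_log_tsum {s : ℝ} (hs : 1 < s) (N : ℕ) :
    ∑ p ∈ N.primesBelow, (p : ℝ) ^ (-s) ≤ Real.log (∑' n : ℕ, (n : ℝ) ^ (-s)) := by
  have h0 : 0 < s := by linarith
  have hsum : Summable fun n : ℕ ↦ (n : ℝ) ^ (-s) := Real.summable_nat_rpow.mpr (by linarith)
  calc _ ≤ ∑ p ∈ N.primesBelow, -Real.log (1 - (p : ℝ) ^ (-s)) := by
        refine Finset.sum_le_sum fun p hp ↦ ?_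
        have := rpow_neg_prime_lt_one h0 (Nat.prime_of_mem_primesBelow hp)
        have := Real.log_le_sub_one_of_pos (x := 1 - (p : ℝ) ^ (-s)) (by linarith)
        linarith
    _ = Real.log (∏ p ∈ N.primesBelow, (1 - (p : ℝ) ^ (-s))⁻¹) :=
        (log_eulerProduct_eq_sum h0 N).symm
    _ ≤ _ := by
        refine Real.log_le_log (eulerProduct_pos h0 N) ?_
        rw [← (hasSum_smoothNumbers_rpow h0 N).tsum_eq]
        exact hsum.tsum_subtype_le (fun n : ℕ ↦ (n : ℝ) ^ (-s)) _ (fun n ↦ by positivity)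

/-- Every `n ≤ t` has only prime factors `≤ t`, so the Euler product at `s = 1` dominates the
harmonic sum, hence `log t`. Taking logarithms, prime powers beyond the first contribute only a
bounded amount. -/
theorem log_log_le_sum_inv_primes_add {t : ℝ} (ht : 1 < t) :
    Real.log (Real.log t) ≤ ∑ p ∈ (⌊t⌋₊ + 1).primesBelow, (p : ℝ)⁻¹ +
      2 * ∑' n : ℕ, ((n : ℝ) ^ 2)⁻¹ := by
  set N := ⌊t⌋₊ + 1
  have hS := hasSum_smoothNumbers_rpow one_pos N
  have hlog : Real.log t ≤ ∏ p ∈ N.primesBelow, (1 - (p : ℝ) ^ (-1 : ℝ))⁻¹ := by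
    refine (log_le_harmonic_floor t (by linarith)).trans ?_
    rw [harmonic_eq_sum_Icc]
    push_cast
    have hsub : ∀ n ∈ Finset.Icc 1 ⌊t⌋₊, n ∈ N.smoothNumbers := fun n hn ↦ by
      rw [Finset.mem_Icc] at hn
      exact Nat.mem_smoothNumbers_of_lt hn.1 (by omega)
    rw [← Finset.sum_subtype_of_mem (p := (· ∈ N.smoothNumbers)) (fun n : ℕ ↦ (n : ℝ)⁻¹) hsub]
    have := sum_le_hasSum (Finset.subtype (· ∈ N.smoothNumbers) (Finset.Icc 1 ⌊t⌋₊))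
      (fun i _ ↦ by positivity) hS
    simpa [Real.rpow_neg_one] using this
  have h2 : Summable fun n : ℕ ↦ ((n : ℝ) ^ 2)⁻¹ := Real.summable_nat_pow_inv.mpr (by norm_num)
  calc _ ≤ Real.log (∏ p ∈ N.primesBelow, (1 - (p : ℝ) ^ (-1 : ℝ))⁻¹) :=
        Real.log_le_log (Real.log_pos ht) hlog
    _ = ∑ p ∈ N.primesBelow, -Real.log (1 - (p : ℝ) ^ (-1 : ℝ)) := log_eulerProduct_eq_sum one_pos N
    _ ≤ ∑ p ∈ N.primesBelow, ((p : ℝ)⁻¹ + 2 * ((p : ℝ) ^ 2)⁻¹) := by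
        refine Finset.sum_le_sum fun p hp ↦ ?_
        have hp2 : (2 : ℝ) ≤ p := by exact_mod_cast (Nat.prime_of_mem_primesBelow hp).two_le
        have hx : (p : ℝ)⁻¹ ≤ 1 / 2 := by rw [one_div]; gcongr
        have hx0 : 0 < (p : ℝ)⁻¹ := by positivity
        rw [Real.rpow_neg_one, ← inv_pow]
        set x := (p : ℝ)⁻¹
        have h1 : 0 < 1 - x := by linarith
        have := Real.one_sub_inv_le_log_of_pos h1
        have h3 : (1 - x)⁻¹ ≤ 1 + x + 2 * x ^ 2 := by
          rw [inv_le_iff_one_le_mul₀ h1]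
          -- `(1 - x) * (1 + x + 2x²) = 1 + x² * (1 - 2x)`.
          nlinarith [mul_nonneg (sq_nonneg x) (by linarith : 0 ≤ 1 - 2 * x)]
        linarith
    _ ≤ _ := by
        rw [Finset.sum_add_distrib, ← Finset.mul_sum]
        gcongr
        exact h2.sum_le_tsum _ (fun _ _ ↦ by positivity)

/-- Rankin's trick: `p ^ δ ≤ t ^ δ` for `p ≤ t` moves the exponent into the region where the full
zeta series converges. -/
theorem sum_inv_primes_le {t δ : ℝ} (ht : 1 ≤ t) (hδ : 0 < δ) :
    ∑ p ∈ (⌊t⌋₊ + 1).primesBelow, (p : ℝ)⁻¹ ≤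
      t ^ δ * Real.log (∑' n : ℕ, (n : ℝ) ^ (-(1 + δ))) := by
  refine le_trans ?_ (mul_le_mul_of_nonneg_left
    (sum_primesBelow_rpow_le_log_tsum (s := 1 + δ) (by linarith) (⌊t⌋₊ + 1)) (by positivity))
  rw [Finset.mul_sum]
  refine Finset.sum_le_sum fun p hp ↦ ?_
  have hp0 : 0 < (p : ℝ) := by exact_mod_cast (Nat.prime_of_mem_primesBelow hp).pos
  have hpt : (p : ℝ) ≤ t := by
    have := Nat.lt_of_mem_primesBelow hp
    exact (Nat.le_floor_iff (by linarith)).mp (by omega)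
  have : (p : ℝ)⁻¹ = (p : ℝ) ^ δ * (p : ℝ) ^ (-(1 + δ)) := by
    rw [← Real.rpow_add hp0, ← Real.rpow_neg_one]
    congr 1; ring
  rw [this]
  gcongr

theorem tendsto_sum_inv_primes_div_log_log :
    Tendsto (fun t : ℝ ↦ (∑ p ∈ (⌊t⌋₊ + 1).primesBelow, (p : ℝ)⁻¹) / Real.log (Real.log t))
      atTop (𝓝 1) := by
  have hL : Tendsto (fun t : ℝ ↦ Real.log (Real.log t)) atTop atTop :=
    Real.tendsto_log_atTop.comp Real.tendsto_log_atTop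
  set C := 2 * ∑' n : ℕ, ((n : ℝ) ^ 2)⁻¹
  have hlow : Tendsto (fun t : ℝ ↦ 1 - C / Real.log (Real.log t)) atTop (𝓝 1) := by
    simpa using tendsto_const_nhds.sub (hL.const_div_atTop C)
  have hup : Tendsto (fun x : ℝ ↦ Real.exp (1 / x) * (1 + Real.log (2 * x) / x)) atTop (𝓝 1) := by
    have h1 : Tendsto (fun x : ℝ ↦ Real.exp (1 / x)) atTop (𝓝 1) := by
      simpa [Function.comp_def] using
        (Real.continuous_exp.tendsto 0).comp (tendsto_id.const_div_atTop (1 : ℝ))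
    have h2 : Tendsto (fun x : ℝ ↦ Real.log (2 * x) / x) atTop (𝓝 0) := by
      have h3 := (Real.isLittleO_log_id_atTop.tendsto_div_nhds_zero.comp
        (tendsto_id.const_mul_atTop (two_pos (α := ℝ)))).const_mul 2
      rw [mul_zero] at h3
      refine h3.congr' ?_
      filter_upwards [eventually_gt_atTop 0] with x hx
      simp only [Function.comp_apply, id]
      field_simp
    simpa using h1.mul (tendsto_const_nhds.add h2)
  -- The choice is `δ = 1 / (L log t)` with `L = log log t`. Taking `δ = 1 / log t` would leave a
  -- factor `e`; the extra `L` gives `t ^ δ = exp (1 / L) → 1` and costs only `log (2L) = o(L)`.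
  have hδ : Tendsto (fun t : ℝ ↦ 1 + 1 / (Real.log (Real.log t) * Real.log t)) atTop (𝓝[>] 1) := by
    refine tendsto_nhdsWithin_iff.mpr ⟨?_, ?_⟩
    · simpa using tendsto_const_nhds.add
        ((hL.atTop_mul_atTop₀ Real.tendsto_log_atTop).const_div_atTop (1 : ℝ))
    · filter_upwards [hL.eventually_gt_atTop 0, Real.tendsto_log_atTop.eventually_gt_atTop 0]
        with t h1 h2
      simp only [Set.mem_Ioi, lt_add_iff_pos_right]
      positivity
  -- The simple pole: `(s - 1) ζ(s) → 1` as `s → 1⁺`, so it is eventually below 2.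
  have hz := (tendsto_sub_mul_tsum_nat_rpow.eventually (eventually_lt_nhds one_lt_two))
  refine tendsto_of_tendsto_of_tendsto_of_le_of_le' hlow (hup.comp hL) ?_ ?_
  · filter_upwards [hL.eventually_gt_atTop 0, eventually_gt_atTop 1] with t h1 h2
    rw [le_div_iff₀ h1, sub_mul, div_mul_cancel₀ _ h1.ne']
    linarith [log_log_le_sum_inv_primes_add h2]
  · filter_upwards [hL.eventually_gt_atTop 0, eventually_gt_atTop 1, hδ.eventually hz,
      Real.tendsto_log_atTop.eventually_gt_atTop 0] with t h1 h2 h3 h4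
    simp only [Function.comp_apply]
    set L := Real.log (Real.log t) with hLdef
    have hδ0 : 0 < 1 / (L * Real.log t) := by positivity
    refine (div_le_div_of_nonneg_right (sum_inv_primes_le h2.le hδ0) h1.le).trans ?_
    have ht : t ^ (1 / (L * Real.log t)) = Real.exp (1 / L) := by
      rw [Real.rpow_def_of_pos (by linarith)]
      congr 1
      field_simp
    rw [ht, mul_div_assoc]
    gcongr
    rw [div_le_iff₀ h1, add_mul, div_mul_cancel₀ _ h1.ne', one_mul]
    have hsum : Summable fun n : ℕ ↦ (n : ℝ) ^ (-(1 + 1 / (L * Real.log t))) :=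
      Real.summable_nat_rpow.mpr (by linarith)
    have hpos : 0 < ∑' n : ℕ, (n : ℝ) ^ (-(1 + 1 / (L * Real.log t))) :=
      hsum.tsum_pos (fun n ↦ by positivity) 1 (by simp)
    have hle : ∑' n : ℕ, (n : ℝ) ^ (-(1 + 1 / (L * Real.log t))) ≤ 2 * L * Real.log t := by
      simp_rw [add_sub_cancel_left, one_div ((_ : ℝ) ^ (_ : ℝ)),
        ← Real.rpow_neg (Nat.cast_nonneg _)] at h3
      rw [one_div_mul_eq_div, div_lt_iff₀ (by positivity)] at h3
      linarith
    refine (Real.log_le_log hpos hle).trans_eq ?_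
    rw [Real.log_mul (by positivity) h4.ne', ← hLdef, add_comm]

/-! ### Equidistribution of linear flows on the torus -/

theorem integral_haarAddCircle_fourier {n : ℤ} (hn : n ≠ 0) :
    ∫ x : UnitAddCircle, fourier n x ∂AddCircle.haarAddCircle = 0 :=
  integral_eq_zero_of_add_right_eq_neg (fourier_add_half_inv_index hn one_pos)

/-- The linear flow on the torus with frequency vector `w`. -/
noncomputable def torusFlow {ι : Type*} (w : ι → ℝ) (τ : ℝ) : UnitAddTorus ι :=
  fun i ↦ ((τ * w i : ℝ) : UnitAddCircle)

theorem continuous_torusFlow {ι : Type*} (w : ι → ℝ) : Continuous (torusFlow w) :=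
  continuous_pi fun i ↦ (AddCircle.continuous_mk' 1).comp (continuous_mul_const (w i))

section Torus

variable {ι : Type*} [Fintype ι]

/-- The normalised Haar measure on the torus `(ℝ / ℤ) ^ ι`. -/
noncomputable def torusMeasure (ι : Type*) [Fintype ι] : Measure (UnitAddTorus ι) :=
  Measure.pi fun _ ↦ AddCircle.haarAddCircle

instance : IsProbabilityMeasure (torusMeasure ι) := by
  unfold torusMeasure; infer_instance

theorem integral_torusMeasure_mFourier {n : ι → ℤ} (hn : n ≠ 0) :
    ∫ x, UnitAddTorus.mFourier n x ∂torusMeasure ι = 0 := by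
  obtain ⟨i, hi⟩ := Function.ne_iff.mp hn
  have : ∫ x, UnitAddTorus.mFourier n x ∂torusMeasure ι =
      ∏ i, ∫ x : UnitAddCircle, fourier (n i) x ∂AddCircle.haarAddCircle :=
    integral_fintype_prod_eq_prod (fun i (x : UnitAddCircle) ↦ (fourier (n i) x : ℂ))
  rw [this]
  exact Finset.prod_eq_zero (Finset.mem_univ i) (integral_haarAddCircle_fourier hi)

theorem mFourier_torusFlow (n : ι → ℤ) (w : ι → ℝ) (τ : ℝ) :
    UnitAddTorus.mFourier n (torusFlow w τ) =
      Complex.exp ((2 * Real.pi * Complex.I * (∑ i, n i * w i : ℝ)) * τ) := by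
  simp only [UnitAddTorus.mFourier, torusFlow, ContinuousMap.coe_mk, fourier_coe_apply]
  rw [← Complex.exp_sum]
  congr 1
  push_cast
  rw [Finset.mul_sum, Finset.sum_mul]
  refine Finset.sum_congr rfl fun i _ ↦ ?_
  ring

theorem integral_uniformMeasure (T : Set.Ioi (0 : ℝ)) (f : ℝ → ℂ) :
    ∫ τ, f τ ∂uniformMeasure T = ((T : ℝ)⁻¹ : ℂ) * ∫ τ in (T : ℝ)..(2 * T), f τ := by
  have hT : (0 : ℝ) < T := T.2
  rw [uniformMeasure, ProbabilityTheory.cond, integral_smul_measure, Real.volume_Icc,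
    integral_Icc_eq_integral_Ioc, ← intervalIntegral.integral_of_le (by linarith),
    ENNReal.toReal_inv, ENNReal.toReal_ofReal (by linarith), Complex.real_smul]
  congr 2
  push_cast; ring

theorem tendsto_integral_uniformMeasure_exp {c : ℝ} (hc : c ≠ 0) :
    Tendsto (fun T ↦ ∫ τ : ℝ, Complex.exp (2 * Real.pi * Complex.I * c * τ) ∂uniformMeasure T)
      atTop (𝓝 0) := by
  have hc' : (2 * Real.pi * Complex.I * c : ℂ) ≠ 0 := by
    simp [Complex.I_ne_zero, Real.pi_ne_zero, hc]
  have hlim : Tendsto (fun T : Set.Ioi (0 : ℝ) ↦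
      (T : ℝ)⁻¹ * (2 / ‖(2 * Real.pi * Complex.I * c : ℂ)‖)) atTop (𝓝 0) := by
    have h : Tendsto (fun T : Set.Ioi (0 : ℝ) ↦ (T : ℝ)) atTop atTop :=
      tendsto_Ioi_atTop.mp tendsto_id
    simpa using (tendsto_inv_atTop_zero.comp h).mul_const
      (2 / ‖(2 * Real.pi * Complex.I * c : ℂ)‖)
  refine squeeze_zero_norm (fun T ↦ ?_) hlim
  have hT : (0 : ℝ) < T := T.2
  rw [integral_uniformMeasure, integral_exp_mul_complex hc', norm_mul, norm_div]
  have hnorm : ‖((T : ℝ)⁻¹ : ℂ)‖ = (T : ℝ)⁻¹ := by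
    rw [norm_inv, Complex.norm_real, Real.norm_of_nonneg hT.le]
  rw [hnorm]
  gcongr
  refine (norm_sub_le _ _).trans ?_
  have hexp (x : ℝ) : ‖Complex.exp (2 * Real.pi * Complex.I * c * x)‖ = 1 := by
    rw [Complex.norm_exp]
    simp
  rw [hexp, hexp]
  norm_num

/-- Kronecker–Weyl for continuous functions on the torus: the linear flow with rationally
independent frequencies equidistributes. -/
theorem tendsto_integral_torusFlow {w : ι → ℝ}
    (hw : ∀ n : ι → ℤ, ∑ i, n i * w i = 0 → n = 0) (f : C(UnitAddTorus ι, ℂ)) :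
    Tendsto (fun T ↦ ∫ τ, f (torusFlow w τ) ∂uniformMeasure T) atTop
      (𝓝 (∫ x, f x ∂torusMeasure ι)) := by
  have hint (f : C(UnitAddTorus ι, ℂ)) (T : Set.Ioi (0 : ℝ)) :
      Integrable (fun τ ↦ f (torusFlow w τ)) (uniformMeasure T) :=
    Integrable.of_bound (f.continuous.comp (continuous_torusFlow w)).aestronglyMeasurable
      ‖f‖ (Eventually.of_forall fun τ ↦ f.norm_coe_le_norm _)
  have hint' (f : C(UnitAddTorus ι, ℂ)) : Integrable f (torusMeasure ι) :=
    Integrable.of_bound f.continuous.aestronglyMeasurable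
      ‖f‖ (Eventually.of_forall fun τ ↦ f.norm_coe_le_norm _)
  have hspan : ∀ g ∈ Submodule.span ℂ (Set.range (UnitAddTorus.mFourier (d := ι))),
      Tendsto (fun T ↦ ∫ τ, g (torusFlow w τ) ∂uniformMeasure T) atTop
        (𝓝 (∫ x, g x ∂torusMeasure ι)) := by
    intro g hg
    induction hg using Submodule.span_induction with
    | mem g hg =>
      obtain ⟨n, rfl⟩ := hg
      by_cases hn : n = 0
      · subst hn
        simp [UnitAddTorus.mFourier_zero]
      · rw [integral_torusMeasure_mFourier hn]
        simp_rw [mFourier_torusFlow]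
        exact tendsto_integral_uniformMeasure_exp fun h ↦ hn (hw n h)
    | zero => simp
    | add f g _ _ hf hg =>
      simp only [ContinuousMap.add_apply]
      rw [integral_add (hint' f) (hint' g)]
      simp_rw [fun T ↦ integral_add (hint f T) (hint g T)]
      exact hf.add hg
    | smul a f _ hf =>
      simp only [ContinuousMap.smul_apply, integral_smul]
      exact hf.const_smul a
  -- Trigonometric polynomials are uniformly dense, and both averages are contractions in the sup
  -- norm.
  have hf : f ∈ closure (Submodule.span ℂ (Set.range (UnitAddTorus.mFourier (d := ι))) :
      Set C(UnitAddTorus ι, ℂ)) := by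
    rw [← Submodule.topologicalClosure_coe, UnitAddTorus.span_mFourier_closure_eq_top]
    trivial
  rw [Metric.tendsto_nhds]
  intro ε hε
  obtain ⟨g, hg, hfg⟩ := Metric.mem_closure_iff.mp hf (ε / 3) (by positivity)
  have hpt (x : UnitAddTorus ι) : ‖f x - g x‖ ≤ ε / 3 := by
    rw [← dist_eq_norm]
    exact (ContinuousMap.dist_apply_le_dist x).trans hfg.le
  have h1 (T : Set.Ioi (0 : ℝ)) : dist (∫ τ, f (torusFlow w τ) ∂uniformMeasure T)
      (∫ τ, g (torusFlow w τ) ∂uniformMeasure T) ≤ ε / 3 := by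
    rw [dist_eq_norm, ← integral_sub (hint f T) (hint g T)]
    refine (norm_integral_le_of_norm_le_const (Eventually.of_forall fun τ ↦ hpt _)).trans ?_
    simp
  have h2 : dist (∫ x, g x ∂torusMeasure ι) (∫ x, f x ∂torusMeasure ι) ≤ ε / 3 := by
    rw [dist_comm, dist_eq_norm, ← integral_sub (hint' f) (hint' g)]
    refine (norm_integral_le_of_norm_le_const (Eventually.of_forall fun τ ↦ hpt _)).trans ?_
    simp
  filter_upwards [Metric.tendsto_nhds.mp (hspan g hg) (ε / 3) (by positivity)] with T hT
  calc _ ≤ _ := dist_triangle4 _ (∫ τ, g (torusFlow w τ) ∂uniformMeasure T)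
        (∫ x, g x ∂torusMeasure ι) _
    _ < ε := by linarith [h1 T]

/-- The law of a continuous observable on the torus under Haar measure. -/
noncomputable def torusLaw {g : UnitAddTorus ι → ℝ} (hg : Continuous g) : ProbabilityMeasure ℝ :=
  ⟨(torusMeasure ι).map g, Measure.isProbabilityMeasure_map hg.measurable.aemeasurable⟩

/-- Kronecker–Weyl as convergence in distribution of observables on the torus. -/
theorem tendstoInDistribution_comp_torusFlow {w : ι → ℝ}
    (hw : ∀ n : ι → ℤ, ∑ i, n i * w i = 0 → n = 0) {g : UnitAddTorus ι → ℝ}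
    (hg : Continuous g) :
    TendstoInDistribution (fun (_ : Set.Ioi (0 : ℝ)) (τ : ℝ) ↦ g (torusFlow w τ)) atTop
      (id : ℝ → ℝ) uniformMeasure
      (torusLaw hg : Measure ℝ) := by
  have hm : Measurable fun τ ↦ g (torusFlow w τ) := (hg.comp (continuous_torusFlow w)).measurable
  refine ⟨fun _ ↦ hm.aemeasurable, aemeasurable_id, ?_⟩
  refine ProbabilityMeasure.tendsto_iff_forall_integral_tendsto.mpr ?_
  intro φ
  have := tendsto_integral_torusFlow hw
    ⟨fun x ↦ ((φ (g x) : ℝ) : ℂ), Complex.continuous_ofReal.comp (φ.continuous.comp hg)⟩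
  simp only [ContinuousMap.coe_mk, integral_complex_ofReal] at this
  have := (Complex.continuous_re.tendsto _).comp this
  simp only [Function.comp_def, Complex.ofReal_re] at this
  simp only [torusLaw, ProbabilityMeasure.coe_mk, Measure.map_id]
  rw [integral_map hg.measurable.aemeasurable φ.continuous.aestronglyMeasurable]
  simp_rw [fun T ↦ integral_map (μ := uniformMeasure T) hm.aemeasurable
    φ.continuous.aestronglyMeasurable]
  exact this

end Torus

/-! ### Gaussian approximation of characteristic functions -/

theorem norm_prod_sub_prod_le_sum {ι R : Type*} [NormedCommRing R] [NormOneClass R]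
    (s : Finset ι) (f g : ι → R)
    (hf : ∀ i ∈ s, ‖f i‖ ≤ 1) (hg : ∀ i ∈ s, ‖g i‖ ≤ 1) :
    ‖∏ i ∈ s, f i - ∏ i ∈ s, g i‖ ≤ ∑ i ∈ s, ‖f i - g i‖ := by
  classical
  induction s using Finset.induction_on with
  | empty => simp
  | insert a s ha ih =>
    rw [Finset.prod_insert ha, Finset.prod_insert ha, Finset.sum_insert ha]
    have h1 : ‖∏ i ∈ s, f i‖ ≤ 1 := (Finset.norm_prod_le s f).trans
      (Finset.prod_le_one (fun _ _ ↦ norm_nonneg _)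
        fun i hi ↦ hf i (Finset.mem_insert_of_mem hi))
    have h2 := ih (fun i hi ↦ hf i (Finset.mem_insert_of_mem hi))
      (fun i hi ↦ hg i (Finset.mem_insert_of_mem hi))
    calc _ = ‖(f a - g a) * ∏ i ∈ s, f i + g a * (∏ i ∈ s, f i - ∏ i ∈ s, g i)‖ := by
          congr 1; ring
      _ ≤ ‖f a - g a‖ * ‖∏ i ∈ s, f i‖ + ‖g a‖ * ‖∏ i ∈ s, f i - ∏ i ∈ s, g i‖ :=
          (norm_add_le _ _).trans (add_le_add (norm_mul_le _ _) (norm_mul_le _ _))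
      _ ≤ ‖f a - g a‖ * 1 + 1 * ∑ i ∈ s, ‖f i - g i‖ := by
          gcongr
          exact hg a (Finset.mem_insert_self a s)
      _ = _ := by ring

theorem norm_exp_mul_I_sub_taylor_le {y : ℝ} (hy : |y| ≤ 1) :
    ‖Complex.exp (y * Complex.I) - (1 + y * Complex.I - y ^ 2 / 2)‖ ≤ |y| ^ 3 := by
  have hn : ‖(y * Complex.I : ℂ)‖ = |y| := by simp
  have h := Complex.exp_bound (x := y * Complex.I) (hn.trans_le hy) (n := 3) (by norm_num)
  rw [hn] at h
  have hs : ∑ m ∈ Finset.range 3, (y * Complex.I : ℂ) ^ m / (m.factorial : ℂ) =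
      1 + y * Complex.I - y ^ 2 / 2 := by
    simp [Finset.sum_range_succ, Nat.factorial, mul_pow]
    ring
  rw [hs] at h
  refine h.trans (mul_le_of_le_one_right (by positivity) ?_)
  norm_num [Nat.factorial]

/-- The characteristic function of the real part of a uniform random variable on the unit circle,
multiplied by a fixed complex number `v`. -/
noncomputable def circleCharFun (v : ℂ) (x : ℝ) : ℂ :=
  ∫ θ : UnitAddCircle, Complex.exp ((x * (v * fourier 1 θ).re : ℝ) * Complex.I)
    ∂AddCircle.haarAddCircle

theorem norm_circleCharFun_le_one (v : ℂ) (x : ℝ) : ‖circleCharFun v x‖ ≤ 1 := by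
  refine (norm_integral_le_of_norm_le_const
    (Eventually.of_forall fun θ ↦ (Complex.norm_exp_ofReal_mul_I _).le)).trans ?_
  simp

theorem integrable_haarAddCircle_of_continuous {E : Type*} [NormedAddCommGroup E]
    {f : UnitAddCircle → E} (hf : Continuous f) :
    Integrable f AddCircle.haarAddCircle :=
  hf.integrable_of_hasCompactSupport (HasCompactSupport.of_compactSpace f)

theorem continuous_re_mul_fourier (v : ℂ) (n : ℤ) :
    Continuous fun θ : UnitAddCircle ↦ (v * fourier n θ).re :=
  Complex.continuous_re.comp (continuous_const.mul (fourier n).continuous)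

theorem integral_re_mul_fourier (v : ℂ) {n : ℤ} (hn : n ≠ 0) :
    ∫ θ : UnitAddCircle, (v * fourier n θ).re ∂AddCircle.haarAddCircle = 0 := by
  have hi : Integrable (fun θ : UnitAddCircle ↦ v * fourier n θ) AddCircle.haarAddCircle :=
    integrable_haarAddCircle_of_continuous (continuous_const.mul (fourier n).continuous)
  have := integral_re hi
  simp only [RCLike.re_to_complex] at this
  rw [this, integral_const_mul, integral_haarAddCircle_fourier hn]
  simp

theorem integral_re_mul_fourier_sq {v : ℂ} (hv : ‖v‖ = 1) :
    ∫ θ : UnitAddCircle, (v * fourier 1 θ).re ^ 2 ∂AddCircle.haarAddCircle = 1 / 2 := by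
  have h (θ : UnitAddCircle) :
      (v * fourier 1 θ).re ^ 2 = 1 / 2 + (v ^ 2 * fourier 2 θ).re / 2 := by
    have h2 : fourier 2 θ = (fourier 1 θ : ℂ) ^ 2 := by
      rw [sq, ← fourier_add]; norm_num
    have hz : ‖v * fourier 1 θ‖ = 1 := by
      rw [norm_mul, hv, fourier_apply, Circle.norm_coe, one_mul]
    rw [h2, ← mul_pow]
    set z := v * fourier 1 θ
    have h3 := Complex.normSq_eq_norm_sq z
    rw [hz, Complex.normSq_apply] at h3
    have h4 : (z ^ 2).re = z.re * z.re - z.im * z.im := by rw [sq, Complex.mul_re]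
    rw [h4]
    linarith [sq z.re]
  have h0 : ∫ θ : UnitAddCircle, (v ^ 2 * fourier 2 θ).re / 2 ∂AddCircle.haarAddCircle = 0 := by
    rw [integral_div, integral_re_mul_fourier _ two_ne_zero, zero_div]
  simp_rw [h]
  rw [integral_add (integrable_const _) (integrable_haarAddCircle_of_continuous
    ((continuous_re_mul_fourier _ _).div_const _)), h0]
  simp

/-- `Re (v * e(θ))` has mean 0 and variance 1/2, so both terms agree with `1 - x² / 4` up to `|x|³`.
-/
theorem norm_circleCharFun_sub_exp_le {v : ℂ} (hv : ‖v‖ = 1) {x : ℝ} (hx : |x| ≤ 1) :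
    ‖circleCharFun v x - Complex.exp ((-(x ^ 2 / 4) : ℝ))‖ ≤ 2 * |x| ^ 3 := by
  have hc := continuous_re_mul_fourier v 1
  have hb (θ : UnitAddCircle) : |x * (v * fourier 1 θ).re| ≤ |x| := by
    rw [abs_mul]
    refine mul_le_of_le_one_right (abs_nonneg x) ((Complex.abs_re_le_norm _).trans ?_)
    rw [norm_mul, hv, fourier_apply, Circle.norm_coe, one_mul]
  have hT : ∫ θ : UnitAddCircle, (1 + (x * (v * fourier 1 θ).re : ℝ) * Complex.I -
      ((x * (v * fourier 1 θ).re : ℝ) : ℂ) ^ 2 / 2) ∂AddCircle.haarAddCircle =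
      ((1 - x ^ 2 / 4 : ℝ) : ℂ) := by
    have e1 : ∫ θ : UnitAddCircle, ((x * (v * fourier 1 θ).re : ℝ) : ℂ) * Complex.I
        ∂AddCircle.haarAddCircle = 0 := by
      rw [integral_mul_const, integral_complex_ofReal, integral_const_mul,
        integral_re_mul_fourier v one_ne_zero]
      simp
    have e2 : ∫ θ : UnitAddCircle, ((x * (v * fourier 1 θ).re : ℝ) : ℂ) ^ 2 / 2
        ∂AddCircle.haarAddCircle = ((x ^ 2 / 4 : ℝ) : ℂ) := by
      rw [integral_div]
      simp_rw [← Complex.ofReal_pow, mul_pow]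
      rw [integral_complex_ofReal, integral_const_mul, integral_re_mul_fourier_sq hv]
      push_cast; ring
    rw [integral_sub, integral_add, e1, e2]
    · simp
    · exact integrable_const _
    all_goals exact integrable_haarAddCircle_of_continuous (by fun_prop)
  have h1 : ‖circleCharFun v x - ((1 - x ^ 2 / 4 : ℝ) : ℂ)‖ ≤ |x| ^ 3 := by
    rw [← hT, circleCharFun, ← integral_sub]
    · refine (norm_integral_le_of_norm_le_const (C := |x| ^ 3)
        (Eventually.of_forall fun θ ↦ ?_)).trans ?_
      · exact (norm_exp_mul_I_sub_taylor_le ((hb θ).trans hx)).trans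
          (pow_le_pow_left₀ (abs_nonneg _) (hb θ) 3)
      · simp
    all_goals exact integrable_haarAddCircle_of_continuous (by fun_prop)
  have hx2 : x ^ 2 ≤ 1 := by rwa [sq_le_one_iff_abs_le_one]
  have h2 : ‖((1 - x ^ 2 / 4 : ℝ) : ℂ) - Complex.exp ((-(x ^ 2 / 4) : ℝ))‖ ≤ |x| ^ 3 := by
    rw [← Complex.ofReal_exp, ← Complex.ofReal_sub, Complex.norm_real, Real.norm_eq_abs,
      abs_sub_comm]
    have h := Real.abs_exp_sub_one_sub_id_le (x := -(x ^ 2 / 4)) (by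
      rw [abs_neg, abs_of_nonneg (by positivity)]; linarith)
    have hle : (-(x ^ 2 / 4)) ^ 2 ≤ |x| ^ 3 := by
      have h4 : |x| ^ 4 ≤ |x| ^ 3 := pow_le_pow_of_le_one (abs_nonneg x) hx (by norm_num)
      have : (-(x ^ 2 / 4)) ^ 2 = |x| ^ 4 / 16 := by
        rw [← sq_abs x]; ring
      rw [this]
      linarith [pow_nonneg (abs_nonneg x) 4]
    refine le_trans (le_of_eq ?_) (h.trans hle)
    congr 1; ring
  calc _ ≤ _ := norm_sub_le_norm_sub_add_norm_sub _ ((1 - x ^ 2 / 4 : ℝ) : ℂ) _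
    _ ≤ _ := by linarith

section Observable

variable {ι : Type*} [Fintype ι]

/-- The random trigonometric sum `∑ i, a i * Re (v * e(θ i))` on the torus. -/
noncomputable def torusSum (a : ι → ℝ) (v : ℂ) (θ : UnitAddTorus ι) : ℝ :=
  ∑ i, a i * (v * fourier 1 (θ i)).re

theorem continuous_torusSum (a : ι → ℝ) (v : ℂ) : Continuous (torusSum a v) :=
  continuous_finsetSum _ fun i _ ↦ continuous_const.mul
    ((continuous_re_mul_fourier v 1).comp (continuous_apply i))

theorem charFun_torusLaw_torusSum (a : ι → ℝ) (v : ℂ) (u : ℝ) :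
    charFun (torusLaw (continuous_torusSum a v) : Measure ℝ) u =
      ∏ i, circleCharFun v (u * a i) := by
  rw [charFun_apply_real]
  simp only [torusLaw, ProbabilityMeasure.coe_mk]
  rw [integral_map (continuous_torusSum a v).measurable.aemeasurable
    (Continuous.aestronglyMeasurable (by fun_prop))]
  refine Eq.trans ?_ (integral_fintype_prod_eq_prod (μ := fun _ ↦ AddCircle.haarAddCircle)
    fun i (θ : UnitAddCircle) ↦
      Complex.exp ((u * a i * (v * fourier 1 θ).re : ℝ) * Complex.I))
  refine integral_congr_ae (Eventually.of_forall fun θ ↦ ?_)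
  simp only [torusSum]
  rw [← Complex.exp_sum]
  congr 1
  push_cast
  rw [Finset.mul_sum, Finset.sum_mul]
  refine Finset.sum_congr rfl fun i _ ↦ ?_
  ring

/-- Independence factors both terms. The cubic errors of the factors add up, and one power of `|u *
a i|` is traded for the uniform bound `m`, as in Lyapunov's condition. -/
theorem norm_charFun_torusSum_sub_le (a : ι → ℝ) {v : ℂ} (hv : ‖v‖ = 1) (u : ℝ) {m : ℝ}
    (hm : m ≤ 1) (ha : ∀ i, |u * a i| ≤ m) :
    ‖charFun (torusLaw (continuous_torusSum a v) : Measure ℝ) u -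
      Complex.exp ((-(u ^ 2 * (∑ i, a i ^ 2) / 4) : ℝ))‖ ≤ 2 * m * (u ^ 2 * ∑ i, a i ^ 2) := by
  have he : Complex.exp ((-(u ^ 2 * (∑ i, a i ^ 2) / 4) : ℝ)) =
      ∏ i, Complex.exp ((-((u * a i) ^ 2 / 4) : ℝ)) := by
    rw [← Complex.exp_sum, ← Complex.ofReal_sum, Finset.sum_neg_distrib, ← Finset.sum_div,
      Finset.mul_sum]
    simp_rw [mul_pow]
  rw [charFun_torusLaw_torusSum, he]
  refine (norm_prod_sub_prod_le_sum _ _ _ (fun i _ ↦ norm_circleCharFun_le_one _ _)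
    fun i _ ↦ ?_).trans ?_
  · rw [← Complex.ofReal_exp, Complex.norm_real, Real.norm_eq_abs, Real.abs_exp]
    exact Real.exp_le_one_iff.mpr (neg_nonpos.mpr (by positivity))
  · rw [Finset.mul_sum, Finset.mul_sum]
    refine Finset.sum_le_sum fun i _ ↦ ?_
    refine (norm_circleCharFun_sub_exp_le hv ((ha i).trans hm)).trans ?_
    have h3 : |u * a i| ^ 3 = |u * a i| * (u ^ 2 * a i ^ 2) := by
      rw [← mul_pow, ← sq_abs (u * a i)]; ring
    rw [h3, mul_assoc]
    have := mul_le_mul_of_nonneg_right (ha i) (by positivity : 0 ≤ u ^ 2 * a i ^ 2)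
    linarith

end Observable

/-! ### Specialisation to the primes -/

/-- Logarithms of distinct primes are linearly independent over the integers. -/
theorem eq_zero_of_sum_mul_log_primes_eq_zero {s : Finset ℕ} (hs : ∀ p ∈ s, p.Prime)
    {n : s → ℤ} (h : ∑ p : s, n p * Real.log p = 0) : n = 0 := by
  have hpos (p : s) : (0 : ℝ) < (p : ℕ) := by exact_mod_cast (hs p p.2).pos
  have hfac (k : s → ℕ) (q : s) : (∏ p : s, (p : ℕ) ^ k p).factorization q = k q := by
    rw [Nat.factorization_prod fun (p : s) _ ↦ pow_ne_zero _ (hs p p.2).ne_zero, Finsupp.finsetSum_apply,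
      Finset.sum_eq_single q]
    · rw [(hs q q.2).factorization_pow, Finsupp.single_eq_same]
    · intro p _ hpq
      rw [(hs p p.2).factorization_pow, Finsupp.single_eq_of_ne]
      exact fun h ↦ hpq (Subtype.ext h.symm)
    · simp
  have hlog (k : s → ℕ) : Real.log ((∏ p : s, (p : ℕ) ^ k p : ℕ) : ℝ) =
      ∑ p : s, (k p : ℝ) * Real.log p := by
    push_cast
    rw [Real.log_prod fun p _ ↦ (pow_pos (hpos p) _).ne']
    simp_rw [Real.log_pow]
  -- Positive and negative parts turn the relation into an equality of two natural numbers, to which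
  -- unique factorization applies.
  have hsplit (p : s) : (n p : ℝ) = (n p).toNat - (-n p).toNat := by
    exact_mod_cast (Int.toNat_sub_toNat_neg (n p)).symm
  have heq : ∏ p : s, (p : ℕ) ^ (n p).toNat = ∏ p : s, (p : ℕ) ^ (-n p).toNat := by
    have hp (k : s → ℕ) : (0 : ℝ) < ((∏ p : s, (p : ℕ) ^ k p : ℕ) : ℝ) := by
      exact Nat.cast_pos.mpr (Finset.prod_pos fun (p : s) _ ↦ pow_pos (hs p p.2).pos _)
    have := Real.log_injOn_pos (hp fun p ↦ (n p).toNat) (hp fun p ↦ (-n p).toNat) (by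
      rw [hlog fun p ↦ (n p).toNat, hlog fun p ↦ (-n p).toNat, ← sub_eq_zero,
        ← Finset.sum_sub_distrib, ← h]
      refine Finset.sum_congr rfl fun p _ ↦ ?_
      rw [hsplit p, sub_mul])
    exact_mod_cast this
  funext q
  have h1 := hfac (fun p ↦ (n p).toNat) q
  have h2 := hfac (fun p ↦ (-n p).toNat) q
  rw [heq, h2] at h1
  simp only [Pi.zero_apply]
  omega

/-- Frequencies, indexed by the primes `p ≤ t`, of the linear flow on the torus giving the phases
of `p ^ (-iτ)`. -/
noncomputable def primeFreq (t : ℝ) (p : (⌊t⌋₊ + 1).primesBelow) : ℝ :=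
  -(Real.log p / (2 * Real.pi))

/-- The normalised coefficients `p ^ (-1/2) / √(½ log log t)`. -/
noncomputable def primeCoeff (t : ℝ) (p : (⌊t⌋₊ + 1).primesBelow) : ℝ :=
  (√(p : ℕ))⁻¹ / √(1 / 2 * Real.log (Real.log t))

theorem primeFreq_independent (t : ℝ) (n : (⌊t⌋₊ + 1).primesBelow → ℤ)
    (h : ∑ p, n p * primeFreq t p = 0) : n = 0 := by
  refine eq_zero_of_sum_mul_log_primes_eq_zero (fun p hp ↦ Nat.prime_of_mem_primesBelow hp) ?_
  have h2 : ∑ p, n p * primeFreq t p =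
      -(∑ p : (⌊t⌋₊ + 1).primesBelow, n p * Real.log p) / (2 * Real.pi) := by
    rw [← Finset.sum_neg_distrib, Finset.sum_div]
    refine Finset.sum_congr rfl fun p _ ↦ ?_
    rw [primeFreq]; ring
  rw [h2, div_eq_zero_iff, neg_eq_zero] at h
  exact h.resolve_right (by positivity)

theorem natCast_cpow_half_line {p : ℕ} (hp : 0 < p) (τ : ℝ) :
    (p : ℂ) ^ (-(1 / 2 + Complex.I * τ) : ℂ) =
      ((√p)⁻¹ : ℝ) * fourier 1 ((τ * -(Real.log p / (2 * Real.pi)) : ℝ) : UnitAddCircle) := by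
  have hp0 : (p : ℂ) ≠ 0 := by exact_mod_cast hp.ne'
  have hpr : (0 : ℝ) < p := by exact_mod_cast hp
  rw [neg_add, Complex.cpow_add _ _ hp0, fourier_coe_apply]
  congr 1
  · rw [Real.sqrt_eq_rpow, ← Real.rpow_neg hpr.le, Complex.ofReal_cpow hpr.le]
    push_cast; rfl
  · rw [Complex.cpow_def_of_ne_zero hp0, ← Complex.natCast_log]
    congr 1
    have : (Real.pi : ℂ) ≠ 0 := by exact_mod_cast Real.pi_ne_zero
    push_cast
    field_simp

theorem re_mul_primeSum_eq_torusSum (v : ℂ) (t τ : ℝ) :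
    (v * primeSum t (1 / 2 + Complex.I * τ)).re / √(1 / 2 * Real.log (Real.log t)) =
      torusSum (primeCoeff t) v (torusFlow (primeFreq t) τ) := by
  have h : primeSum t (1 / 2 + Complex.I * τ) = ∑ p : (⌊t⌋₊ + 1).primesBelow,
      (((p : ℕ) : ℂ) ^ (-(1 / 2 + Complex.I * τ) : ℂ)) :=
    (Finset.sum_coe_sort (⌊t⌋₊ + 1).primesBelow
      fun p : ℕ ↦ (p : ℂ) ^ (-(1 / 2 + Complex.I * τ) : ℂ)).symm
  rw [h, Finset.mul_sum, Complex.re_sum, Finset.sum_div, torusSum]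
  refine Finset.sum_congr rfl fun p _ ↦ ?_
  rw [natCast_cpow_half_line (Nat.prime_of_mem_primesBelow p.2).pos, mul_left_comm,
    Complex.re_ofReal_mul, primeCoeff, torusFlow, primeFreq]
  ring

/-- The limit 2 offsets the variance 1/2 of each summand. -/
theorem tendsto_sum_primeCoeff_sq :
    Tendsto (fun t ↦ ∑ p, primeCoeff t p ^ 2) atTop (𝓝 2) := by
  have hL : Tendsto (fun t : ℝ ↦ Real.log (Real.log t)) atTop atTop :=
    Real.tendsto_log_atTop.comp Real.tendsto_log_atTop
  have h := tendsto_sum_inv_primes_div_log_log.const_mul 2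
  rw [mul_one] at h
  refine h.congr' ?_
  filter_upwards [hL.eventually_gt_atTop 0] with t ht
  rw [← Finset.sum_coe_sort, Finset.sum_div, Finset.mul_sum]
  refine Finset.sum_congr rfl fun p _ ↦ ?_
  rw [primeCoeff, div_pow, inv_pow, Real.sq_sqrt (Nat.cast_nonneg _), Real.sq_sqrt (by positivity)]
  field_simp

theorem abs_mul_primeCoeff_le (u t : ℝ) (p : (⌊t⌋₊ + 1).primesBelow) :
    |u * primeCoeff t p| ≤ |u| / √(1 / 2 * Real.log (Real.log t)) := by
  have hp : (1 : ℝ) ≤ √(p : ℕ) := by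
    rw [Real.one_le_sqrt]
    exact_mod_cast (Nat.prime_of_mem_primesBelow p.2).one_lt.le
  rw [abs_mul, primeCoeff, abs_div, abs_of_nonneg (Real.sqrt_nonneg _), ← mul_div_assoc,
    abs_of_nonneg (inv_nonneg.mpr (Real.sqrt_nonneg _))]
  gcongr
  exact mul_le_of_le_one_right (abs_nonneg u) (inv_le_one_of_one_le₀ hp)

/-- The limit law of `Re (v * P_t(1/2 + iτ)) / √(½ log log t)`. -/
noncomputable def primeLaw (v : ℂ) (t : ℝ) : ProbabilityMeasure ℝ :=
  torusLaw (continuous_torusSum (primeCoeff t) v)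

theorem tendsto_charFun_primeLaw {v : ℂ} (hv : ‖v‖ = 1) (u : ℝ) :
    Tendsto (fun t ↦ charFun (primeLaw v t : Measure ℝ) u) atTop
      (𝓝 (charFun (stdNormal : Measure ℝ) u)) := by
  have hL : Tendsto (fun t : ℝ ↦ √(1 / 2 * Real.log (Real.log t))) atTop atTop :=
    Real.tendsto_sqrt_atTop.comp ((Real.tendsto_log_atTop.comp
      Real.tendsto_log_atTop).const_mul_atTop one_half_pos)
  have hm := hL.const_div_atTop |u|
  have hS := tendsto_sum_primeCoeff_sq.const_mul (u ^ 2)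
  have hexp : Tendsto (fun t ↦
      Complex.exp ((-(u ^ 2 * (∑ p, primeCoeff t p ^ 2) / 4) : ℝ))) atTop
      (𝓝 (charFun (stdNormal : Measure ℝ) u)) := by
    have hc : charFun (stdNormal : Measure ℝ) u = Complex.exp ((-(u ^ 2 * 2 / 4) : ℝ)) := by
      simp only [stdNormal, ProbabilityMeasure.coe_mk]
      rw [charFun_gaussianReal]
      congr 1
      push_cast
      ring
    rw [hc]
    exact (Complex.continuous_exp.tendsto _).comp
      ((Complex.continuous_ofReal.tendsto _).comp (hS.div_const 4).neg)
  have herr : Tendsto (fun t ↦ charFun (primeLaw v t : Measure ℝ) u -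
      Complex.exp ((-(u ^ 2 * (∑ p, primeCoeff t p ^ 2) / 4) : ℝ))) atTop (𝓝 0) := by
    have hb := (hm.const_mul 2).mul hS
    rw [mul_zero, zero_mul] at hb
    refine squeeze_zero_norm' ?_ hb
    filter_upwards [hm.eventually (eventually_le_nhds zero_lt_one)] with t ht
    exact norm_charFun_torusSum_sub_le _ hv u ht (abs_mul_primeCoeff_le u t)
  simpa using herr.add hexp

theorem tendsto_primeLaw {v : ℂ} (hv : ‖v‖ = 1) :
    Tendsto (primeLaw v) atTop (𝓝 stdNormal) :=
  -- Lévy's continuity theorem is applied along sequences `t_n → ∞`, which suffice as `atTop` on `ℝ`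
  -- is countably generated.
  tendsto_of_seq_tendsto fun _ hx ↦ ProbabilityMeasure.tendsto_of_tendsto_charFun
    fun u ↦ (tendsto_charFun_primeLaw hv u).comp hx

theorem tendstoInDistribution_primeSum (v : ℂ) (t : ℝ) :
    TendstoInDistribution
      (fun (_ : Set.Ioi (0 : ℝ)) (τ : ℝ) ↦
        (v * primeSum t (1 / 2 + Complex.I * (τ : ℂ))).re / √(1 / 2 * Real.log (Real.log t)))
      atTop (id : ℝ → ℝ) uniformMeasure (primeLaw v t : Measure ℝ) := by
  simp_rw [re_mul_primeSum_eq_torusSum]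
  exact tendstoInDistribution_comp_torusFlow (primeFreq_independent t) (continuous_torusSum _ v)

theorem lemma1 :
    (∃ ν : ℝ → ProbabilityMeasure ℝ,
      (∀ t : ℝ, Real.exp 1 < t →
        TendstoInDistribution
          (fun (_ : Set.Ioi (0 : ℝ)) (τ : ℝ) =>
            (primeSum t (1 / 2 + Complex.I * (τ : ℂ))).re / √(1 / 2 * Real.log (Real.log t)))
          atTop (id : ℝ → ℝ) uniformMeasure (ν t : Measure ℝ)) ∧
      Tendsto ν atTop (𝓝 stdNormal)) ∧
    (∃ ν : ℝ → ProbabilityMeasure ℝ,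
      (∀ t : ℝ, Real.exp 1 < t →
        TendstoInDistribution
          (fun (_ : Set.Ioi (0 : ℝ)) (τ : ℝ) =>
            (primeSum t (1 / 2 + Complex.I * (τ : ℂ))).im / √(1 / 2 * Real.log (Real.log t)))
          atTop (id : ℝ → ℝ) uniformMeasure (ν t : Measure ℝ)) ∧
      Tendsto ν atTop (𝓝 stdNormal)) := by
  refine ⟨⟨primeLaw 1, fun t _ ↦ ?_, tendsto_primeLaw (by simp)⟩,
    ⟨primeLaw (-Complex.I), fun t _ ↦ ?_, tendsto_primeLaw (by simp)⟩⟩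
  · simpa only [one_mul] using tendstoInDistribution_primeSum 1 t
  · have h := tendstoInDistribution_primeSum (-Complex.I) t
    have him (z : ℂ) : (-Complex.I * z).re = z.im := by simp
    simpa only [him] using h
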